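/- Let $\mathbb H$ be the real quaternions, $\mathbb S=\{I\in\mathbb H: I^2=-1\}$, and let $\Omega\subseteq\mathbb H$ be a domain (a non-empty connected open set). A function $f:\Omega\to\mathbb H$ is called (slice) regular if for every $I\in\mathbb S$ the restriction $f_I$ of $f$ to $\Omega_I=\Omega\cap(\mathbb R+I\mathbb R)$ has continuous partial derivatives and satisfies $\tfrac12\left(\tfrac{\partial}{\partial x}+I\tfrac{\partial}{\partial y}\right)f_I(x+Iy)=0$ on $\Omega_I$. For $p,q\in\mathbb H$ put $\sigma(q,p)=\tau(q,p)=|q-p|$ if $p,q$ lie on the same complex line $\mathbb R+I\mathbb R$, $I\in\mathbb S$, and otherwise $$\sigma(q,p)=\sqrt{(\mathrm{Re}\,q-\mathrm{Re}\,p)^2+(|\mathrm{Im}\,q|+|\mathrm{Im}\,p|)^2},\qquad \tau(q,p)=\sqrt{(\mathrm{Re}\,q-\mathrm{Re}\,p)^2+(|\mathrm{Im}\,q|-|\mathrm{Im}\,p|)^2}.$$ For $0\le R_1<R_2\le+\infty$ let $\Sigma(p,R_1,R_2)=\{q\in\mathbb H:\tau(q,p)>R_1,\ \sigma(q,p)<R_2\}$.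 The $*$-product of polynomials with coefficients on the right is $\left(\sum_n q^na_n\right)*\left(\sum_n q^nb_n\right)=\sum_n q^n\sum_{k=0}^n a_kb_{n-k}$; the regular conjugate of $g(q)=\sum_n q^na_n$ is $g^c(q)=\sum_n q^n\bar a_n$, its symmetrization is $g^s=g*g^c$, and its regular reciprocal is $g^{-*}=\frac1{g^s}g^c$ where $g^s\ne0$. For $n\ge0$, $(q-p)^{*n}$ is the $n$-th $*$-power of $q\mapsto q-p$; for $m>0$, $(q-p)^{*(-m)}$ is the regular reciprocal of $(q-p)^{*m}$. It equals $(q-p)^{-m}$ at the points $q\ne p,\bar p$ of the complex line through $p$, and for $p\notin\mathbb R$ it is given the value $(\bar p-p)^{-m}$ at $q=\bar p$. Let $f$ be a regular function on $\Omega$ and let $p\in\mathbb H$. Call a pair $(R_1,R_2)$ with $0\le R_1<R_2\le+\infty$ admissible if $\Sigma(p,R_1,R_2)\subseteq\Omega$, and let $V\subseteq(0,+\infty)$ be the union of the open intervals $(R_1,R_2)$ over all admissible pairs. Then for every connected component $C$ of $V$ there exists a single sequence $\{a_n\}_{n\in\mathbb Z}$ in $\mathbb H$ such that, for every admissible pair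 $(R_1,R_2)$ with $(R_1,R_2)\subseteq C$, $$f(q)=\sum_{n\in\mathbb Z}(q-p)^{*n}a_n\qquad\text{for all } q\in\Sigma(p,R_1,R_2),$$ where the series converges absolutely. In particular, for every admissible pair $(R_1,R_2)$ the function $f$ has such an expansion in $\Sigma(p,R_1,R_2)$, and if $V$ is connected then one sequence serves for all admissible pairs. -/

import Mathlib

open scoped Quaternion ENNReal

noncomputable section

namespace SliceRegular

/-- The 2-sphere of imaginary units of the real quaternions. -/
def imaginaryUnits : Set ℍ := {I | I ^ 2 = -1}

/-- The point `x + I y` of the complex line `ℝ + I ℝ`. -/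
def slicePoint (I : ℍ) (x y : ℝ) : ℍ := (x : ℍ) + I * (y : ℍ)

/-- The complex line `ℝ + I ℝ`. -/
def sliceLine (I : ℍ) : Set ℍ := {q | ∃ x y : ℝ, q = slicePoint I x y}

/-- The slice of `Ω` along `ℝ + I ℝ`, in the coordinates `(x, y)` of `x + I y`. -/
def sliceSet (Ω : Set ℍ) (I : ℍ) : Set (ℝ × ℝ) := {z | slicePoint I z.1 z.2 ∈ Ω}

/-- The restriction of `f` to the slice of `Ω` along `ℝ + I ℝ` is holomorphic: it has continuous
partial derivatives `fx`, `fy` with respect to `x`, `y`, and `(1/2) (∂/∂x + I ∂/∂y) f = 0`. -/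
def HolomorphicOnSlice (f : ℍ → ℍ) (Ω : Set ℍ) (I : ℍ) : Prop :=
  ∃ fx fy : ℝ × ℝ → ℍ,
    ContinuousOn fx (sliceSet Ω I) ∧ ContinuousOn fy (sliceSet Ω I) ∧
    ∀ z ∈ sliceSet Ω I,
      HasDerivAt (fun x : ℝ => f (slicePoint I x z.2)) (fx z) z.1 ∧
      HasDerivAt (fun y : ℝ => f (slicePoint I z.1 y)) (fy z) z.2 ∧
      (2 : ℝ)⁻¹ • (fx z + I * fy z) = 0

/-- `f` is (slice) regular on the open set `Ω`. -/
def RegularOn (f : ℍ → ℍ) (Ω : Set ℍ) : Prop :=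
  ∀ I ∈ imaginaryUnits, HolomorphicOnSlice f Ω I

/-- Two quaternions lie on the same complex line `ℝ + I ℝ`. -/
def SameLine (q p : ℍ) : Prop :=
  ∃ I ∈ imaginaryUnits, q ∈ sliceLine I ∧ p ∈ sliceLine I

/-- `ω(q,p)`. -/
def omegaDist (q p : ℍ) : ℝ := √((q.re - p.re) ^ 2 + (‖q.im‖ + ‖p.im‖) ^ 2)

open Classical in
/-- `σ(q,p)`. -/
def sigmaDist (q p : ℍ) : ℝ := if SameLine q p then ‖q - p‖ else omegaDist q p

open Classical in
/-- `τ(q,p)`. -/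
def tauDist (q p : ℍ) : ℝ :=
  if SameLine q p then ‖q - p‖ else √((q.re - p.re) ^ 2 + (‖q.im‖ - ‖p.im‖) ^ 2)

/-- `Σ(p,R₁,R₂) = {q : τ(q,p) > R₁, σ(q,p) < R₂}`. -/
def sigmaShell (p : ℍ) (R₁ R₂ : ℝ≥0∞) : Set ℍ :=
  {q | R₁ < ENNReal.ofReal (tauDist q p) ∧ ENNReal.ofReal (sigmaDist q p) < R₂}

/-- The regular polynomial function `q ↦ ∑ qᵏ aₖ` with coefficients `aₖ` on the right. Products in
`Polynomial ℍ` (where the variable commutes with the coefficients, so that the `n`-th coefficient of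
a product is `∑ aₖ bₙ₋ₖ`) correspond to `*`-products of such functions. -/
def regularEval (P : Polynomial ℍ) (q : ℍ) : ℍ := P.sum fun k a => q ^ k * a

/-- The regular conjugate `∑ qᵏ āₖ` of `∑ qᵏ aₖ`. -/
def regularConj (P : Polynomial ℍ) : Polynomial ℍ :=
  P.sum fun k a => Polynomial.monomial k (star a)

/-- The symmetrization `f * fᶜ`. -/
def symmetrization (P : Polynomial ℍ) : Polynomial ℍ := P * regularConj P

/-- The regular reciprocal `(1 / fˢ) fᶜ`, meaningful outside the zero set of `fˢ`. -/
def regularReciprocal (P : Polynomial ℍ) (q : ℍ) : ℍ :=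
  (regularEval (symmetrization P) q)⁻¹ * regularEval (regularConj P) q

open Classical in
/-- The integer powers `(q - p)^{*n}` with respect to the `*`-product. For `n = -m < 0` this is the
regular reciprocal of `(q - p)^{*m}`, a function on the complement of the sphere
`Re p + |Im p| 𝕊`. On the complex line through `p` it equals `(q - p)^{-m}`, and it is extended by
this formula to the point `q = p̄` of that sphere (the formula `(1 / fˢ) fᶜ` is `0 / 0` there). -/
def starPow (p : ℍ) : ℤ → ℍ → ℍ
  | Int.ofNat n, q => regularEval ((Polynomial.X - Polynomial.C p) ^ n) q
  | Int.negSucc m, q =>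
      if q = star p then ((q - p) ^ (m + 1))⁻¹
      else regularReciprocal ((Polynomial.X - Polynomial.C p) ^ (m + 1)) q

/-- The pairs of radii `0 ≤ R₁ < R₂ ≤ +∞` with `Σ(p,R₁,R₂) ⊆ Ω`. -/
def Admissible (Ω : Set ℍ) (p : ℍ) (R₁ R₂ : ℝ≥0∞) : Prop :=
  R₁ < R₂ ∧ sigmaShell p R₁ R₂ ⊆ Ω

/-- The union of the open intervals `(R₁,R₂)` over all admissible pairs. -/
def admissibleRadii (Ω : Set ℍ) (p : ℍ) : Set ℝ≥0∞ :=
  {r | ∃ R₁ R₂ : ℝ≥0∞, Admissible Ω p R₁ R₂ ∧ r ∈ Set.Ioo R₁ R₂}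

end SliceRegular

end

/-! Let `J` be a unit with `p` on `ℝ + J ℝ`. Left multiplication by that line makes `ℍ` a complex
Banach space, and regularity makes the restriction of `f` to the line holomorphic, so it has a
classical Laurent series on annuli around `p` (`hasSum_laurentCoeff`). Its coefficients are circle
integrals, locally constant in the radius, hence constant on each component of the admissible radii.

To leave the line, both sides obey the same representation formula: the value at `x + I y` is a
fixed real-linear, right `ℍ`-linear combination (`represent`) of the values at `x + J y` and `x - J
y`. For `f` this is the identity theorem along an arc from the real axis that stays in the shell
(`RegularOn.eq_represent_of_mem_sigmaShell`); for `(q - p)^{*n}` it is algebra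
(`starPow_slicePoint`). Off the line, the distances of `x ± J y` from `p` are `τ` and `σ`, so both
points lie in the annulus, and `represent` combines their two Laurent series termwise. -/

/-! ### Laurent series of Banach-space-valued holomorphic functions -/

noncomputable section LaurentSeries

open Metric Complex

variable {E : Type*} [NormedAddCommGroup E] [NormedSpace ℂ E]

/-- The `n`-th Laurent coefficient of `g` around `c`, computed on the circle of radius `r`. -/
def laurentCoeff (g : ℂ → E) (c : ℂ) (r : ℝ) (n : ℤ) : E :=
  (2 * Real.pi * I : ℂ)⁻¹ • ∮ w in C(c, r), (w - c) ^ (-n - 1) • g w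

theorem laurentCoeff_eq_of_differentiableOn [CompleteSpace E] {g : ℂ → E} {c : ℂ} {U : Set ℂ}
    (hU : IsOpen U) (hg : DifferentiableOn ℂ g U) {r R : ℝ} (hr : 0 < r) (hrR : r ≤ R)
    (hsub : closedBall c R \ ball c r ⊆ U) (n : ℤ) :
    laurentCoeff g c R n = laurentCoeff g c r n := by
  have hd : ∀ z ∈ closedBall c R \ ball c r,
      DifferentiableAt ℂ (fun w => (w - c) ^ (-n - 1) • g w) z := by
    intro z hz
    have hzc : z - c ≠ 0 := by
      rintro h
      apply hz.2
      rw [sub_eq_zero.1 h]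
      exact mem_ball_self hr
    refine DifferentiableAt.smul ?_ (hg.differentiableAt (hU.mem_nhds (hsub hz)))
    exact DifferentiableAt.zpow (by fun_prop) (Or.inl hzc)
  unfold laurentCoeff
  rw [circleIntegral_eq_of_differentiable_on_annulus_off_countable hr hrR Set.countable_empty
    (fun z hz => (hd z hz).continuousAt.continuousWithinAt)]
  rintro z ⟨⟨h1, h2⟩, -⟩
  exact hd z ⟨ball_subset_closedBall h1, fun h => h2 (ball_subset_closedBall h)⟩

theorem norm_laurentCoeff_le {g : ℂ → E} {c : ℂ} {r M : ℝ} (hr : 0 < r)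
    (hM : ∀ z ∈ sphere c r, ‖g z‖ ≤ M) (n : ℤ) :
    ‖laurentCoeff g c r n‖ ≤ r ^ (-n) * M := by
  refine (circleIntegral.norm_two_pi_i_inv_smul_integral_le_of_norm_le_const
    (C := r ^ (-n - 1) * M) hr.le ?_).trans_eq ?_
  · intro z hz
    rw [norm_smul, norm_zpow, mem_sphere_iff_norm.1 hz]
    gcongr
    exact hM z hz
  · rw [← mul_assoc, ← zpow_one_add₀ hr.ne']
    congr 2
    ring

theorem ContinuousLinearMap.map_laurentCoeff [CompleteSpace E] (ℓ : E →L[ℂ] ℂ) {g : ℂ → E} {c : ℂ}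
    {r : ℝ} (hr : 0 < r) (hg : ContinuousOn g (sphere c r)) (n : ℤ) :
    ℓ (laurentCoeff g c r n) = laurentCoeff (fun z => ℓ (g z)) c r n := by
  have hci : ∀ θ : ℝ, circleMap c r θ - c ≠ 0 := fun θ => by simp [circleMap, hr.ne']
  unfold laurentCoeff circleIntegral
  rw [map_smul, ← ContinuousLinearMap.intervalIntegral_comp_comm]
  · simp
  · apply Continuous.intervalIntegrable
    have h1 : Continuous fun θ : ℝ => g (circleMap c r θ) :=
      hg.comp_continuous (continuous_circleMap c r) (circleMap_mem_sphere c hr.le)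
    have h2 : Continuous fun θ : ℝ => (circleMap c r θ - c) ^ (-n - 1) :=
      ((continuous_circleMap c r).sub continuous_const).zpow₀ _ fun θ => Or.inl (hci θ)
    have h3 : Continuous fun θ : ℝ => deriv (circleMap c r) θ := by
      simp only [deriv_circleMap]
      exact (continuous_circleMap 0 r).mul continuous_const
    exact h3.smul (h2.smul h1)

local instance : Fact (0 < 2 * Real.pi) := ⟨Real.two_pi_pos⟩

/-- On the circle of radius `r` the Laurent series is the Fourier series of `θ ↦ g (c + r e^{iθ})`,
with coefficients `rⁿ` times the Laurent ones. A continuous function with summable Fourier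
coefficients is the pointwise sum of its series. -/
theorem hasSum_laurentCoeff_of_summable_aux {g : ℂ → ℂ} {c : ℂ} {r : ℝ} (hr : 0 < r)
    (hg : ContinuousOn g (sphere c r))
    {z : ℂ} (hz : z ∈ sphere c r)
    (hs : Summable fun n : ℤ => (z - c) ^ n * laurentCoeff g c r n) :
    HasSum (fun n : ℤ => (z - c) ^ n * laurentCoeff g c r n) (g z) := by
  have hmem : ∀ x : AddCircle (2 * Real.pi), c + r * (AddCircle.toCircle x : ℂ) ∈ sphere c r := by
    intro x
    have h : ‖(AddCircle.toCircle x : ℂ)‖ = 1 := Circle.norm_coe _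
    simp [h, abs_of_pos hr]
  let F : C(AddCircle (2 * Real.pi), ℂ) :=
    ⟨fun x => g (c + r * (AddCircle.toCircle x : ℂ)), hg.comp_continuous (by
      have := AddCircle.continuous_toCircle (T := 2 * Real.pi)
      fun_prop) hmem⟩
  have hcm : ∀ θ : ℝ, c + r * (AddCircle.toCircle (θ : AddCircle (2 * Real.pi)) : ℂ)
      = circleMap c r θ := by
    intro θ
    rw [AddCircle.toCircle_apply_mk, Circle.coe_exp, circleMap]
    congr 4
    field_simp
  have hFc : ∀ θ : ℝ, F (θ : AddCircle (2 * Real.pi)) = g (circleMap c r θ) := fun θ =>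
    congrArg g (hcm θ)
  have hco : ∀ n : ℤ, fourierCoeff F n = r ^ n * laurentCoeff g c r n := by
    intro n
    rw [fourierCoeff_eq_intervalIntegral _ _ 0, laurentCoeff, circleIntegral, zero_add,
      Complex.real_smul, smul_eq_mul, ← mul_assoc, mul_comm ((r : ℂ) ^ n), mul_assoc]
    have hI : (2 * Real.pi * I : ℂ)⁻¹ = ((1 / (2 * Real.pi) : ℝ) : ℂ) * I⁻¹ := by
      push_cast
      rw [mul_inv, one_div]
    rw [hI, mul_assoc]
    simp only [← intervalIntegral.integral_const_mul]
    apply intervalIntegral.integral_congr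
    intro θ _
    have hr' : (r : ℂ) ≠ 0 := by exact_mod_cast hr.ne'
    simp only [deriv_circleMap, smul_eq_mul]
    rw [hFc, fourier_coe_apply]
    have e1 : circleMap c r θ - c = r * exp (θ * I) := by simp [circleMap]
    have e2 : circleMap 0 r θ = r * exp (θ * I) := by simp [circleMap]
    rw [e1, e2, mul_zpow, sub_eq_add_neg, zpow_add₀ hr', zpow_add₀ (exp_ne_zero _), zpow_neg,
      zpow_neg, zpow_neg, zpow_neg, zpow_one, zpow_one, ← exp_int_mul, ← exp_neg]
    have e3 : (2 * Real.pi * I * ((-n : ℤ) : ℂ) * θ / ((2 * Real.pi : ℝ) : ℂ) : ℂ)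
        = -(n * (θ * I)) := by
      have : (Real.pi : ℂ) ≠ 0 := by exact_mod_cast Real.pi_ne_zero
      push_cast
      field_simp
    rw [e3]
    field_simp [exp_ne_zero]
  obtain ⟨θ, hθ⟩ : ∃ θ : ℝ, circleMap c r θ = z := by
    rw [← abs_of_pos hr, ← range_circleMap] at hz
    exact hz
  have hterm : ∀ n : ℤ, fourierCoeff F n • fourier n (θ : AddCircle (2 * Real.pi))
      = (z - c) ^ n * laurentCoeff g c r n := by
    intro n
    have e1 : z - c = r * exp (θ * I) := by rw [← hθ]; simp [circleMap]
    rw [hco, e1, mul_zpow, smul_eq_mul, fourier_coe_apply, ← exp_int_mul]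
    have e3 : (2 * Real.pi * I * n * θ / ((2 * Real.pi : ℝ) : ℂ) : ℂ)
        = n * (θ * I) := by
      have : (Real.pi : ℂ) ≠ 0 := by exact_mod_cast Real.pi_ne_zero
      push_cast
      field_simp
    rw [e3]
    ring
  -- Characters have modulus one, so the Fourier coefficients have the norms of the Laurent terms at
  -- `z`.
  have hsF : Summable (fourierCoeff F) := by
    refine Summable.of_norm ?_
    refine hs.norm.congr fun n => ?_
    rw [← hterm, norm_smul, fourier_apply, Circle.norm_coe, mul_one]
  have := has_pointwise_sum_fourier_series_of_summable hsF (θ : AddCircle (2 * Real.pi))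
  simp only [hterm] at this
  rwa [hFc, hθ] at this

/-- Continuous functionals separate points and commute with the circle integral, which reduces this
to scalar `g`. -/
theorem hasSum_laurentCoeff_of_summable [CompleteSpace E] {g : ℂ → E} {c : ℂ} {r : ℝ} (hr : 0 < r)
    (hg : ContinuousOn g (sphere c r)) {z : ℂ} (hz : z ∈ sphere c r)
    (hs : Summable fun n : ℤ => (z - c) ^ n • laurentCoeff g c r n) :
    HasSum (fun n : ℤ => (z - c) ^ n • laurentCoeff g c r n) (g z) := by
  convert hs.hasSum using 1
  rw [SeparatingDual.eq_iff_forall_dual_eq (R := ℂ)]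
  intro ℓ
  have hℓ : ∀ n : ℤ, ℓ ((z - c) ^ n • laurentCoeff g c r n)
      = (z - c) ^ n * laurentCoeff (fun z => ℓ (g z)) c r n := by
    intro n
    rw [map_smul, ContinuousLinearMap.map_laurentCoeff ℓ hr hg, smul_eq_mul]
  have h1 := ℓ.hasSum hs.hasSum
  simp only [hℓ] at h1
  exact (hasSum_laurentCoeff_of_summable_aux hr (ℓ.continuous.comp_continuousOn hg) hz
    h1.summable).unique h1

/-- **Laurent expansion** of a holomorphic function on an annulus. -/
theorem hasSum_laurentCoeff [CompleteSpace E] {g : ℂ → E} {c : ℂ} {U : Set ℂ}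
    (hU : IsOpen U) (hg : DifferentiableOn ℂ g U) {r R : ℝ} (hr : 0 < r)
    (hsub : closedBall c R \ ball c r ⊆ U) {z : ℂ} (hrz : r < ‖z - c‖) (hzR : ‖z - c‖ < R) :
    HasSum (fun n : ℤ => (z - c) ^ n • laurentCoeff g c ‖z - c‖ n) (g z) := by
  have hρ : 0 < ‖z - c‖ := hr.trans hrz
  have hR : 0 < R := hρ.trans hzR
  have hsph : ∀ s, r ≤ s → s ≤ R → sphere c s ⊆ U := by
    intro s h1 h2 w hw
    refine hsub ⟨?_, ?_⟩
    · rw [mem_closedBall, mem_sphere.1 hw]; exact h2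
    · rw [mem_ball, mem_sphere.1 hw]; exact not_lt.2 h1
  have hbd : ∀ s, r ≤ s → s ≤ R → ∃ M, ∀ w ∈ sphere c s, ‖g w‖ ≤ M := fun s h1 h2 =>
    (isCompact_sphere c s).exists_bound_of_continuousOn (hg.continuousOn.mono (hsph s h1 h2))
  refine hasSum_laurentCoeff_of_summable hρ (hg.continuousOn.mono (hsph _ hrz.le hzR.le))
    (mem_sphere_iff_norm.2 rfl) ?_
  -- Cauchy estimates on the outer circle control the nonnegative indices with ratio `‖z - c‖ / R`;
  -- those on the inner circle control the nonpositive ones with ratio `r / ‖z - c‖`.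
  have hcoR : ∀ n, laurentCoeff g c ‖z - c‖ n = laurentCoeff g c R n := fun n =>
    (laurentCoeff_eq_of_differentiableOn hU hg hρ hzR.le
      ((Set.sdiff_subset_sdiff_right (ball_subset_ball hrz.le)).trans hsub) n).symm
  have hcor : ∀ n, laurentCoeff g c ‖z - c‖ n = laurentCoeff g c r n := fun n =>
    laurentCoeff_eq_of_differentiableOn hU hg hr hrz.le
      ((Set.sdiff_subset_sdiff_left (closedBall_subset_closedBall hzR.le)).trans hsub) n
  obtain ⟨M, hM⟩ := hbd R (hrz.trans hzR).le le_rfl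
  obtain ⟨m, hm⟩ := hbd r le_rfl (hrz.trans hzR).le
  refine Summable.of_nat_of_neg ?_ ?_
  · refine Summable.of_norm_bounded (g := fun n : ℕ => (‖z - c‖ / R) ^ n * M)
      ((summable_geometric_of_lt_one (by positivity) ((div_lt_one hR).2 hzR)).mul_right _) ?_
    intro n
    rw [hcoR, norm_smul, norm_zpow]
    refine (mul_le_mul_of_nonneg_left (norm_laurentCoeff_le hR hM n) (by positivity)).trans_eq ?_
    rw [div_pow, zpow_neg, zpow_natCast, zpow_natCast]
    ring
  · refine Summable.of_norm_bounded (g := fun n : ℕ => (r / ‖z - c‖) ^ n * m)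
      ((summable_geometric_of_lt_one (by positivity) ((div_lt_one hρ).2 hrz)).mul_right _) ?_
    intro n
    rw [hcor, norm_smul, norm_zpow]
    refine (mul_le_mul_of_nonneg_left (norm_laurentCoeff_le hr hm _) (by positivity)).trans_eq ?_
    rw [div_pow, zpow_neg, neg_neg, zpow_natCast, zpow_natCast]
    ring

end LaurentSeries

/-! ### Complex lines in `ℍ`, holomorphy on slices, the representation formula -/

noncomputable section SliceGeometry

open Metric Complex SliceRegular

namespace SliceRegular

variable {I J : ℍ}

theorem mul_self_of_mem_imaginaryUnits (hI : I ∈ imaginaryUnits) : I * I = -1 := by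
  rw [← pow_two]; exact hI

theorem norm_of_mem_imaginaryUnits (hI : I ∈ imaginaryUnits) : ‖I‖ = 1 := by
  have h := congrArg norm (mul_self_of_mem_imaginaryUnits hI)
  rw [norm_mul, norm_neg, norm_one] at h
  nlinarith [norm_nonneg I]

theorem re_of_mem_imaginaryUnits (hI : I ∈ imaginaryUnits) : I.re = 0 := by
  have h1 := Quaternion.normSq_eq_norm_mul_self I
  rw [norm_of_mem_imaginaryUnits hI, Quaternion.normSq_def'] at h1
  have h2 := congrArg QuaternionAlgebra.re (mul_self_of_mem_imaginaryUnits hI)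
  rw [Quaternion.re_mul, Quaternion.re_neg, Quaternion.re_one] at h2
  nlinarith

theorem slicePoint_eq (I : ℍ) (x y : ℝ) : slicePoint I x y = (x : ℍ) + y • I := by
  rw [slicePoint, Quaternion.mul_coe_eq_smul]

@[simp]
theorem slicePoint_zero_right (I : ℍ) (x : ℝ) : slicePoint I x 0 = x := by
  simp [slicePoint]

theorem re_slicePoint (hI : I ∈ imaginaryUnits) (x y : ℝ) : (slicePoint I x y).re = x := by
  simp [slicePoint_eq, re_of_mem_imaginaryUnits hI]

theorem im_slicePoint (hI : I ∈ imaginaryUnits) (x y : ℝ) : (slicePoint I x y).im = y • I := by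
  have h : I.im = I := by
    rw [← Quaternion.sub_re_self, re_of_mem_imaginaryUnits hI, Quaternion.coe_zero, sub_zero]
  simp [slicePoint_eq, h]

theorem norm_im_slicePoint (hI : I ∈ imaginaryUnits) (x y : ℝ) :
    ‖(slicePoint I x y).im‖ = |y| := by
  rw [im_slicePoint hI, norm_smul, norm_of_mem_imaginaryUnits hI, mul_one, Real.norm_eq_abs]

theorem star_slicePoint (hI : I ∈ imaginaryUnits) (x y : ℝ) :
    star (slicePoint I x y) = slicePoint I x (-y) := by
  have h : star I = -I := by
    ext <;> simp [re_of_mem_imaginaryUnits hI]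
  simp [slicePoint_eq, h]

theorem norm_sq_eq_re_im (q : ℍ) : ‖q‖ ^ 2 = q.re ^ 2 + ‖q.im‖ ^ 2 := by
  rw [pow_two, pow_two ‖q.im‖, ← Quaternion.normSq_eq_norm_mul_self,
    ← Quaternion.normSq_eq_norm_mul_self, Quaternion.normSq_def', Quaternion.normSq_def']
  simp
  ring

theorem norm_slicePoint (hI : I ∈ imaginaryUnits) (x y : ℝ) :
    ‖slicePoint I x y‖ = √(x ^ 2 + y ^ 2) := by
  rw [eq_comm, Real.sqrt_eq_iff_eq_sq (by positivity) (norm_nonneg _), norm_sq_eq_re_im,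
    re_slicePoint hI, norm_im_slicePoint hI, sq_abs]

theorem exists_eq_slicePoint (q : ℍ) :
    ∃ I ∈ imaginaryUnits, q = slicePoint I q.re ‖q.im‖ := by
  by_cases h : q.im = 0
  · refine ⟨((Complex.I : ℂ) : ℍ), ?_, ?_⟩
    · change ((Complex.I : ℂ) : ℍ) ^ 2 = -1
      rw [pow_two, ← Quaternion.coeComplex_mul, Complex.I_mul_I]
      ext <;> simp
    · rw [h, norm_zero, slicePoint_zero_right, ← Quaternion.sub_im_self, h, sub_zero]
  · have hn : ‖q.im‖ ≠ 0 := norm_ne_zero_iff.2 h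
    refine ⟨‖q.im‖⁻¹ • q.im, ?_, ?_⟩
    · have h1 : q.im * q.im = -((‖q.im‖ * ‖q.im‖ : ℝ) : ℍ) := by
        rw [← Quaternion.normSq_eq_norm_mul_self, ← Quaternion.self_mul_star, Quaternion.star_im]
        simp
      rw [imaginaryUnits, Set.mem_ofPred_eq, pow_two, smul_mul_smul_comm, h1, smul_neg,
        ← Quaternion.coe_smul, smul_eq_mul]
      congr 1
      rw [← Quaternion.coe_one]
      congr 1
      field_simp
    · rw [slicePoint_eq, smul_smul, mul_inv_cancel₀ hn, one_smul, Quaternion.re_add_im]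

/-- The ring embedding of `ℂ` in `ℍ` with image the complex line `ℝ + I ℝ`. -/
def sliceHom (I : ℍ) (hI : I ∈ imaginaryUnits) : ℂ →+* ℍ :=
  (Complex.liftAux I (mul_self_of_mem_imaginaryUnits hI)).toRingHom

theorem sliceHom_apply (hI : I ∈ imaginaryUnits) (z : ℂ) :
    sliceHom I hI z = slicePoint I z.re z.im :=
  (Complex.liftAux_apply I (mul_self_of_mem_imaginaryUnits hI) z).trans
    (slicePoint_eq I z.re z.im).symm

theorem norm_sliceHom (hI : I ∈ imaginaryUnits) (z : ℂ) : ‖sliceHom I hI z‖ = ‖z‖ := by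
  rw [sliceHom_apply, norm_slicePoint hI, Complex.norm_eq_sqrt_sq_add_sq]

/-- The complex normed space structure on `ℍ` given by left multiplication with elements of
`ℝ + I ℝ`. -/
abbrev sliceNormedSpace (I : ℍ) (hI : I ∈ imaginaryUnits) : NormedSpace ℂ ℍ :=
  { Module.compHom ℍ (sliceHom I hI) with
    norm_smul_le := fun z q => by
      change ‖sliceHom I hI z * q‖ ≤ _
      rw [norm_mul, norm_sliceHom] }

/-- Continuous partials give a real Fréchet derivative, and `gy = I * gx` makes it complex-linear. A
general `g` is allowed because the combination formed by `represent` is also needed. -/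
theorem differentiableOn_of_partialDeriv (hI : I ∈ imaginaryUnits) {U : Set (ℝ × ℝ)}
    (hU : IsOpen U) {g : ℝ → ℝ → ℍ} {gx gy : ℝ × ℝ → ℍ} (hgx : ContinuousOn gx U)
    (hgy : ContinuousOn gy U)
    (h : ∀ z ∈ U, HasDerivAt (fun x => g x z.2) (gx z) z.1 ∧
      HasDerivAt (fun y => g z.1 y) (gy z) z.2 ∧ gx z + I * gy z = 0) :
    letI := sliceNormedSpace I hI
    DifferentiableOn ℂ (fun w : ℂ => g w.re w.im) {w : ℂ | (w.re, w.im) ∈ U} := by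
  intro w hw
  have hw' : (w.re, w.im) ∈ U := hw
  have hT : Continuous fun v : ℍ => ContinuousLinearMap.toSpanSingleton ℝ v :=
    (ContinuousLinearMap.toSpanSingletonCLE (𝕜 := ℝ) (E := ℍ)).continuous
  have key := hasStrictFDerivAt_uncurry_coprod (𝕜 := ℝ) (u := (w.re, w.im)) (f := g)
    (f₁ := fun x y => ContinuousLinearMap.toSpanSingleton ℝ (gx (x, y)))
    (f₂ := fun x y => ContinuousLinearMap.toSpanSingleton ℝ (gy (x, y)))
    (Filter.eventually_of_mem (hU.mem_nhds hw') fun v hv => (h v hv).1.hasFDerivAt)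
    (Filter.eventually_of_mem (hU.mem_nhds hw') fun v hv => (h v hv).2.1.hasFDerivAt)
    (hT.continuousAt.comp (hgx.continuousAt (hU.mem_nhds hw')))
    (hT.continuousAt.comp (hgy.continuousAt (hU.mem_nhds hw')))
  have hc : HasFDerivAt (fun w : ℂ => g w.re w.im) _ w :=
    HasFDerivAt.comp w (f := Complex.equivRealProdCLM) key.hasFDerivAt
      Complex.equivRealProdCLM.hasFDerivAt
  have hgyx : gy (w.re, w.im) = I * gx (w.re, w.im) := by
    have h3 := congrArg (I * ·) (h _ hw').2.2
    simp only [mul_add, ← mul_assoc, mul_self_of_mem_imaginaryUnits hI, mul_zero] at h3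
    rw [neg_one_mul, ← sub_eq_add_neg, sub_eq_zero] at h3
    exact h3.symm
  let _ := sliceNormedSpace I hI
  have hd : HasDerivAt (fun w : ℂ => g w.re w.im) (gx (w.re, w.im)) w := by
    rw [hasDerivAt_iff_isLittleO]
    rw [hasFDerivAt_iff_isLittleO] at hc
    convert! hc using 3 with w'
    change sliceHom I hI (w' - w) * gx (w.re, w.im) = _
    rw [sliceHom_apply, slicePoint_eq]
    simp [hgyx, add_mul, Function.HasUncurry.uncurry]
    rw [← Quaternion.coe_sub, Quaternion.coe_mul_eq_smul]
  exact hd.differentiableAt.differentiableWithinAt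

theorem continuous_slicePoint (I : ℍ) : Continuous fun z : ℝ × ℝ => slicePoint I z.1 z.2 := by
  unfold slicePoint
  exact (Quaternion.continuous_coe.comp continuous_fst).add
    (continuous_const.mul (Quaternion.continuous_coe.comp continuous_snd))

theorem isOpen_sliceSet {Ω : Set ℍ} (hΩ : IsOpen Ω) (I : ℍ) : IsOpen (sliceSet Ω I) :=
  hΩ.preimage (continuous_slicePoint I)

theorem HolomorphicOnSlice.exists_partialDeriv {f : ℍ → ℍ} {Ω : Set ℍ}
    (hf : HolomorphicOnSlice f Ω I) : ∃ fx fy : ℝ × ℝ → ℍ,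
      ContinuousOn fx (sliceSet Ω I) ∧ ContinuousOn fy (sliceSet Ω I) ∧
      ∀ z ∈ sliceSet Ω I,
        HasDerivAt (fun x : ℝ => f (slicePoint I x z.2)) (fx z) z.1 ∧
        HasDerivAt (fun y : ℝ => f (slicePoint I z.1 y)) (fy z) z.2 ∧ fx z + I * fy z = 0 := by
  obtain ⟨fx, fy, h1, h2, h3⟩ := hf
  refine ⟨fx, fy, h1, h2, fun z hz => ⟨(h3 z hz).1, (h3 z hz).2.1, ?_⟩⟩
  exact (smul_eq_zero.1 (h3 z hz).2.2).resolve_left (by norm_num)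

theorem HolomorphicOnSlice.differentiableOn {f : ℍ → ℍ} {Ω : Set ℍ} (hΩ : IsOpen Ω)
    (hI : I ∈ imaginaryUnits) (hf : HolomorphicOnSlice f Ω I) :
    letI := sliceNormedSpace I hI
    DifferentiableOn ℂ (fun w : ℂ => f (slicePoint I w.re w.im))
      {w : ℂ | slicePoint I w.re w.im ∈ Ω} := by
  obtain ⟨fx, fy, h1, h2, h3⟩ := hf.exists_partialDeriv
  exact differentiableOn_of_partialDeriv hI (isOpen_sliceSet hΩ I)
    (g := fun x y => f (slicePoint I x y)) h1 h2 h3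

/-- The right-hand side of the representation formula: the value at `x + I y` of the slice function
with values `u` at `x + J y` and `v` at `x - J y`. -/
def represent (J I u v : ℍ) : ℍ := (2 : ℝ)⁻¹ • ((1 - I * J) * u + (1 + I * J) * v)

theorem represent_self (J I u : ℍ) : represent J I u u = u := by
  rw [represent, ← add_mul, sub_add_add_cancel, add_mul, one_mul, ← two_smul ℝ u, smul_smul,
    inv_mul_cancel₀ two_ne_zero, one_smul]

/-- The factors intertwine the units: `I (1 - I J) = I + J = (1 - I J) J` and `I (1 + I J) = I - J =
-(1 + I J) J`. -/
theorem mul_represent (hI : I ∈ imaginaryUnits) (hJ : J ∈ imaginaryUnits) (u v : ℍ) :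
    I * represent J I u v = represent J I (J * u) (-(J * v)) := by
  have h1 : I * (1 - I * J) = (1 - I * J) * J := by
    rw [mul_sub, sub_mul, ← mul_assoc, mul_assoc I J J, mul_self_of_mem_imaginaryUnits hI,
      mul_self_of_mem_imaginaryUnits hJ]
    simp [add_comm]
  have h2 : I * (1 + I * J) = -((1 + I * J) * J) := by
    rw [mul_add, add_mul, ← mul_assoc, mul_assoc I J J, mul_self_of_mem_imaginaryUnits hI,
      mul_self_of_mem_imaginaryUnits hJ]
    simp
  rw [represent, represent, mul_smul_comm, mul_add, ← mul_assoc, ← mul_assoc, h1, h2]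
  simp only [mul_assoc, neg_mul, mul_neg]

theorem represent_add (J I u v u' v' : ℍ) :
    represent J I (u + u') (v + v') = represent J I u v + represent J I u' v' := by
  simp only [represent, mul_add, smul_add]
  abel

theorem represent_mul_right (J I u v a : ℍ) :
    represent J I u v * a = represent J I (u * a) (v * a) := by
  simp only [represent, smul_mul_assoc, add_mul, mul_assoc]

theorem _root_.ContinuousOn.represent {X : Type*} [TopologicalSpace X] (J I : ℍ) {u v : X → ℍ}
    {s : Set X} (hu : ContinuousOn u s) (hv : ContinuousOn v s) :
    ContinuousOn (fun z => SliceRegular.represent J I (u z) (v z)) s := by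
  unfold SliceRegular.represent
  fun_prop

theorem _root_.HasDerivAt.represent (J I : ℍ) {u v : ℝ → ℍ} {u' v' : ℍ} {t : ℝ}
    (hu : HasDerivAt u u' t) (hv : HasDerivAt v v' t) :
    HasDerivAt (fun t => SliceRegular.represent J I (u t) (v t)) (SliceRegular.represent J I u' v') t :=
  ((hu.const_mul (1 - I * J)).add (hv.const_mul (1 + I * J))).const_smul (2 : ℝ)⁻¹

/-- Reflecting `y` flips the sign of `fy`, which matches the sign in `mul_represent`; the
Cauchy–Riemann equation for `I` thus reduces to those for `J` at the two conjugate points. -/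
theorem HolomorphicOnSlice.differentiableOn_represent {f : ℍ → ℍ} {Ω : Set ℍ} (hΩ : IsOpen Ω)
    (hI : I ∈ imaginaryUnits) (hJ : J ∈ imaginaryUnits) (hf : HolomorphicOnSlice f Ω J) :
    letI := sliceNormedSpace I hI
    DifferentiableOn ℂ (fun w : ℂ =>
        represent J I (f (slicePoint J w.re w.im)) (f (slicePoint J w.re (-w.im))))
      {w : ℂ | slicePoint J w.re w.im ∈ Ω ∧ slicePoint J w.re (-w.im) ∈ Ω} := by
  obtain ⟨fx, fy, h1, h2, h3⟩ := hf.exists_partialDeriv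
  let U : Set (ℝ × ℝ) := {z | slicePoint J z.1 z.2 ∈ Ω ∧ slicePoint J z.1 (-z.2) ∈ Ω}
  have hR : Continuous fun z : ℝ × ℝ => (z.1, -z.2) := by fun_prop
  have hU : IsOpen U := (isOpen_sliceSet hΩ J).inter ((isOpen_sliceSet hΩ J).preimage hR)
  have hU1 : ∀ z ∈ U, z ∈ sliceSet Ω J := fun z hz => hz.1
  have hU2 : ∀ z ∈ U, (z.1, -z.2) ∈ sliceSet Ω J := fun z hz => hz.2
  have hgx : ContinuousOn (fun z => represent J I (fx z) (fx (z.1, -z.2))) U :=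
    (h1.mono hU1).represent J I (h1.comp hR.continuousOn hU2)
  have hgy : ContinuousOn (fun z => represent J I (fy z) (-fy (z.1, -z.2))) U :=
    (h2.mono hU1).represent J I (h2.comp hR.continuousOn hU2).neg
  have hd : ∀ z ∈ U,
      HasDerivAt (fun x => represent J I (f (slicePoint J x z.2)) (f (slicePoint J x (-z.2))))
        (represent J I (fx z) (fx (z.1, -z.2))) z.1 ∧
      HasDerivAt (fun y => represent J I (f (slicePoint J z.1 y)) (f (slicePoint J z.1 (-y))))
        (represent J I (fy z) (-fy (z.1, -z.2))) z.2 ∧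
      represent J I (fx z) (fx (z.1, -z.2)) + I * represent J I (fy z) (-fy (z.1, -z.2)) = 0 := by
    intro z hz
    obtain ⟨a1, a2, a3⟩ := h3 z (hU1 z hz)
    obtain ⟨b1, b2, b3⟩ := h3 _ (hU2 z hz)
    refine ⟨HasDerivAt.represent J I a1 b1, HasDerivAt.represent J I a2 ?_, ?_⟩
    · have := HasDerivAt.scomp z.2 b2 (hasDerivAt_neg z.2)
      rwa [neg_one_smul] at this
    · rw [mul_represent hI hJ, mul_neg, neg_neg, ← represent_add, a3, b3, represent_self]
  exact differentiableOn_of_partialDeriv hI hU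
    (g := fun x y => represent J I (f (slicePoint J x y)) (f (slicePoint J x (-y)))) hgx hgy hd

/-- **Representation formula** along a path that starts on the real axis. -/
theorem RegularOn.eq_represent {f : ℍ → ℍ} {Ω : Set ℍ} (hf : RegularOn f Ω) (hΩ : IsOpen Ω)
    (hI : I ∈ imaginaryUnits) (hJ : J ∈ imaginaryUnits) {γ : ℝ → ℝ} (hγ : Continuous γ) (y : ℝ)
    (h : ∀ t ∈ Set.Icc (0 : ℝ) 1, slicePoint I (γ t) (t * y) ∈ Ω ∧
      slicePoint J (γ t) (t * y) ∈ Ω ∧ slicePoint J (γ t) (-(t * y)) ∈ Ω) :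
    f (slicePoint I (γ 1) y) =
      represent J I (f (slicePoint J (γ 1) y)) (f (slicePoint J (γ 1) (-y))) := by
  have hG := (hf J hJ).differentiableOn_represent hΩ hI hJ
  have hF := (hf I hI).differentiableOn hΩ hI
  let _ := sliceNormedSpace I hI
  have hop : ∀ K : ℍ, IsOpen {w : ℂ | slicePoint K w.re w.im ∈ Ω} := fun K =>
    (isOpen_sliceSet hΩ K).preimage Complex.equivRealProdCLM.continuous
  have hopG : IsOpen {w : ℂ | slicePoint J w.re w.im ∈ Ω ∧ slicePoint J w.re (-w.im) ∈ Ω} :=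
    (hop J).inter ((hop J).preimage Complex.continuous_conj)
  let path : ℝ → ℂ := fun t => ⟨γ t, t * y⟩
  have hpath : Continuous path :=
    Complex.equivRealProdCLM.symm.continuous.comp (hγ.prodMk (by fun_prop : Continuous (· * y)))
  have hconn : IsPreconnected (path '' Set.Icc 0 1) :=
    isPreconnected_Icc.image _ hpath.continuousOn
  -- Analyticity near a connected path suffices for the identity theorem, so the slices of `Ω` need
  -- not be connected.
  have hF' : AnalyticOnNhd ℂ (fun w : ℂ => f (slicePoint I w.re w.im)) (path '' Set.Icc 0 1) := by
    refine (hF.analyticOnNhd (hop I)).mono ?_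
    rintro _ ⟨t, ht, rfl⟩
    exact (h t ht).1
  have hG' : AnalyticOnNhd ℂ (fun w : ℂ =>
      represent J I (f (slicePoint J w.re w.im)) (f (slicePoint J w.re (-w.im))))
      (path '' Set.Icc 0 1) := by
    refine (hG.analyticOnNhd hopG).mono ?_
    rintro _ ⟨t, ht, rfl⟩
    exact (h t ht).2
  have h0 : path 0 ∈ path '' Set.Icc 0 1 := ⟨0, by simp, rfl⟩
  -- At real points both sides equal `f`, and real points accumulate at `path 0`.
  have hfreq : ∃ᶠ w in nhdsWithin (path 0) {path 0}ᶜ, f (slicePoint I w.re w.im) =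
      represent J I (f (slicePoint J w.re w.im)) (f (slicePoint J w.re (-w.im))) := by
    have h00 : path 0 = ((γ 0 : ℝ) : ℂ) := by
      simp [path, Complex.ext_iff]
    rw [h00]
    have ht : Filter.Tendsto (fun s : ℝ => (s : ℂ)) (nhdsWithin (γ 0) {γ 0}ᶜ)
        (nhdsWithin ((γ 0 : ℝ) : ℂ) {((γ 0 : ℝ) : ℂ)}ᶜ) := by
      refine tendsto_nhdsWithin_iff.2 ⟨?_, ?_⟩
      · exact Complex.continuous_ofReal.continuousAt.tendsto.mono_left nhdsWithin_le_nhds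
      · filter_upwards [self_mem_nhdsWithin] with s hs
        simpa using hs
    refine ht.frequently (Filter.Eventually.frequently (Filter.Eventually.of_forall fun s => ?_))
    simp [represent_self]
  have := hF'.eqOn_of_preconnected_of_frequently_eq hG' hconn h0 hfreq
    (⟨1, by simp, rfl⟩ : path 1 ∈ path '' Set.Icc 0 1)
  simpa [path] using this

end SliceRegular

end SliceGeometry

/-! ### Integer `*`-powers of `q - p` -/

noncomputable section StarPowers

open Metric Complex SliceRegular

namespace SliceRegular

variable {I J : ℍ}

theorem slicePoint_mul_represent (hI : I ∈ imaginaryUnits) (hJ : J ∈ imaginaryUnits) (x y : ℝ)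
    (u v : ℍ) :
    slicePoint I x y * represent J I u v =
      represent J I (slicePoint J x y * u) (slicePoint J x (-y) * v) := by
  have h1 : ∀ (t : ℝ) (u v : ℍ), t • represent J I u v = represent J I (t • u) (t • v) := by
    intro t u v
    simp only [represent, mul_smul_comm, ← smul_add]
    rw [smul_comm]
  simp only [slicePoint_eq, add_mul, Quaternion.coe_mul_eq_smul, smul_mul_assoc, h1,
    mul_represent hI hJ, represent_add, neg_smul, smul_neg, neg_mul]

theorem represent_slicePoint (hI : I ∈ imaginaryUnits) (hJ : J ∈ imaginaryUnits) (x y : ℝ) :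
    represent J I (slicePoint J x y) (slicePoint J x (-y)) = slicePoint I x y := by
  have h := slicePoint_mul_represent hI hJ x y 1 1
  rw [represent_self] at h
  simpa using h.symm

theorem slicePoint_pow (hI : I ∈ imaginaryUnits) (hJ : J ∈ imaginaryUnits) (x y : ℝ) (k : ℕ) :
    slicePoint I x y ^ k = represent J I (slicePoint J x y ^ k) (slicePoint J x (-y) ^ k) := by
  induction k with
  | zero => simp [represent_self]
  | succ k ih => rw [pow_succ', ih, slicePoint_mul_represent hI hJ, ← pow_succ', ← pow_succ']

theorem represent_unit_self (hI : I ∈ imaginaryUnits) (u v : ℍ) : represent I I u v = u := by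
  rw [represent, mul_self_of_mem_imaginaryUnits hI, sub_neg_eq_add, add_neg_cancel, zero_mul,
    add_zero, add_mul, one_mul, ← two_smul ℝ u, smul_smul, inv_mul_cancel₀ two_ne_zero, one_smul]

theorem regularEval_add (P Q : Polynomial ℍ) (q : ℍ) :
    regularEval (P + Q) q = regularEval P q + regularEval Q q :=
  Polynomial.sum_add_index P Q _ (by simp) (by simp [mul_add])

theorem regularEval_monomial (k : ℕ) (a q : ℍ) :
    regularEval (Polynomial.monomial k a) q = q ^ k * a :=
  Polynomial.sum_monomial_index a _ (by simp)

theorem regularEval_slicePoint (hI : I ∈ imaginaryUnits) (hJ : J ∈ imaginaryUnits)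
    (P : Polynomial ℍ) (x y : ℝ) :
    regularEval P (slicePoint I x y) =
      represent J I (regularEval P (slicePoint J x y)) (regularEval P (slicePoint J x (-y))) := by
  induction P using Polynomial.induction_on' with
  | add P Q hP hQ => simp only [regularEval_add, hP, hQ, represent_add]
  | monomial k a =>
    simp only [regularEval_monomial]
    rw [slicePoint_pow hI hJ, represent_mul_right]

/-- Points and coefficients on one complex line commute, so `*`-calculus there is ordinary complex
algebra. -/
theorem regularEval_map (hJ : J ∈ imaginaryUnits) (Q : Polynomial ℂ) (w : ℂ) :
    regularEval (Q.map (sliceHom J hJ)) (sliceHom J hJ w) = sliceHom J hJ (Q.eval w) := by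
  induction Q using Polynomial.induction_on' with
  | add P Q hP hQ => simp only [Polynomial.map_add, regularEval_add, hP, hQ, Polynomial.eval_add,
      map_add]
  | monomial k a =>
    rw [Polynomial.map_monomial, regularEval_monomial, Polynomial.eval_monomial, mul_comm a,
      map_mul, map_pow]

theorem slicePoint_neg_im (hJ : J ∈ imaginaryUnits) (w : ℂ) :
    slicePoint J w.re (-w.im) = sliceHom J hJ (starRingEnd ℂ w) := by
  rw [sliceHom_apply, conj_re, conj_im]

theorem star_sliceHom (hJ : J ∈ imaginaryUnits) (w : ℂ) :
    star (sliceHom J hJ w) = sliceHom J hJ (starRingEnd ℂ w) := by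
  rw [sliceHom_apply, sliceHom_apply, star_slicePoint hJ, conj_re, conj_im]

theorem coeff_regularConj (P : Polynomial ℍ) (k : ℕ) :
    (regularConj P).coeff k = star (P.coeff k) := by
  rw [regularConj, Polynomial.sum_def, Polynomial.finsetSum_coeff]
  simp only [Polynomial.coeff_monomial]
  rw [Finset.sum_ite_eq']
  split_ifs with h
  · rfl
  · rw [Polynomial.notMem_support_iff.1 h, star_zero]

theorem regularConj_map (hJ : J ∈ imaginaryUnits) (Q : Polynomial ℂ) :
    regularConj (Q.map (sliceHom J hJ)) = (Q.map (starRingEnd ℂ)).map (sliceHom J hJ) := by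
  ext1 k
  rw [coeff_regularConj, Polynomial.coeff_map, Polynomial.coeff_map, Polynomial.coeff_map,
    star_sliceHom]

theorem map_X_sub_C_pow (hJ : J ∈ imaginaryUnits) (c : ℂ) (m : ℕ) :
    (Polynomial.X - Polynomial.C (sliceHom J hJ c)) ^ m =
      ((Polynomial.X - Polynomial.C c) ^ m).map (sliceHom J hJ) := by
  simp

/-- The symmetrization corresponds to the real polynomial `(X - c)^m (X - c̄)^m`, with conjugate
values `s` and `s̄` at `w` and `w̄`. Its value on the slice of `I` is the copy of `s` there, and
dividing by it divides the two arguments of `represent` by `s` and `s̄`. -/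
theorem regularReciprocal_slicePoint (hI : I ∈ imaginaryUnits) (hJ : J ∈ imaginaryUnits)
    {c w : ℂ} (hw : w ≠ c) (hw' : starRingEnd ℂ w ≠ c) (m : ℕ) :
    regularReciprocal ((Polynomial.X - Polynomial.C (sliceHom J hJ c)) ^ m)
        (slicePoint I w.re w.im) =
      represent J I (sliceHom J hJ ((w - c) ^ m)⁻¹)
        (sliceHom J hJ ((starRingEnd ℂ w - c) ^ m)⁻¹) := by
  have hz : slicePoint J w.re w.im = sliceHom J hJ w := (sliceHom_apply hJ w).symm
  have h1 : w - c ≠ 0 := sub_ne_zero.2 hw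
  have h2 : starRingEnd ℂ w - c ≠ 0 := sub_ne_zero.2 hw'
  have h3 : w - starRingEnd ℂ c ≠ 0 := fun h => h2 (by
    simpa using congrArg (starRingEnd ℂ) h)
  set s : ℂ := (w - c) ^ m * (w - starRingEnd ℂ c) ^ m with hs
  have hs0 : s ≠ 0 := mul_ne_zero (pow_ne_zero _ h1) (pow_ne_zero _ h3)
  have hconj : starRingEnd ℂ s =
      (starRingEnd ℂ w - c) ^ m * (starRingEnd ℂ w - starRingEnd ℂ c) ^ m := by
    simp [hs, mul_comm]
  have hsym : regularEval (symmetrization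
      ((Polynomial.X - Polynomial.C (sliceHom J hJ c)) ^ m)) (slicePoint I w.re w.im) =
      slicePoint I s.re s.im := by
    rw [← represent_slicePoint hI hJ s.re s.im, regularEval_slicePoint hI hJ, hz, slicePoint_neg_im hJ, symmetrization,
      map_X_sub_C_pow, regularConj_map, ← Polynomial.map_mul, regularEval_map, regularEval_map,
      ← sliceHom_apply hJ, slicePoint_neg_im hJ, hconj]
    simp [hs]
  have hne : slicePoint I s.re s.im ≠ 0 := by
    rw [← sliceHom_apply hI, ← norm_ne_zero_iff, norm_sliceHom, norm_ne_zero_iff]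
    exact hs0
  rw [regularReciprocal, hsym, inv_mul_eq_iff_eq_mul₀ hne, slicePoint_mul_represent hI hJ,
    regularEval_slicePoint hI hJ, hz, slicePoint_neg_im hJ, map_X_sub_C_pow, regularConj_map, regularEval_map,
    regularEval_map, ← sliceHom_apply hJ]
  rw [slicePoint_neg_im hJ, ← map_mul, ← map_mul, hconj, hs]
  congr 2
  · rw [mul_comm ((w - c) ^ m), mul_assoc, mul_inv_cancel₀ (pow_ne_zero _ h1)]
    simp
  · rw [mul_comm ((starRingEnd ℂ w - c) ^ m), mul_assoc, mul_inv_cancel₀ (pow_ne_zero _ h2)]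
    simp

theorem starPow_ofNat_slicePoint (hI : I ∈ imaginaryUnits) (hJ : J ∈ imaginaryUnits)
    (c w : ℂ) (n : ℕ) :
    starPow (sliceHom J hJ c) n (slicePoint I w.re w.im) =
      represent J I (sliceHom J hJ ((w - c) ^ n)) (sliceHom J hJ ((starRingEnd ℂ w - c) ^ n)) := by
  change regularEval _ _ = _
  rw [regularEval_slicePoint hI hJ, slicePoint_neg_im hJ, ← sliceHom_apply hJ, map_X_sub_C_pow, regularEval_map,
    regularEval_map]
  simp

/-- The representation formula for the integer `*`-powers of `q - p`. -/
theorem starPow_slicePoint (hI : I ∈ imaginaryUnits) (hJ : J ∈ imaginaryUnits)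
    {c w : ℂ} (hw : w ≠ c) (hw' : starRingEnd ℂ w ≠ c) (n : ℤ) :
    starPow (sliceHom J hJ c) n (slicePoint I w.re w.im) =
      represent J I (sliceHom J hJ ((w - c) ^ n)) (sliceHom J hJ ((starRingEnd ℂ w - c) ^ n)) := by
  cases n with
  | ofNat n => simpa using starPow_ofNat_slicePoint hI hJ c w n
  | negSucc m =>
    -- The special value at `p̄` is not in play: equal real parts and equal `|Im|` would force `w =
    -- c` or `w̄ = c`.
    have hne : slicePoint I w.re w.im ≠ star (sliceHom J hJ c) := by
      intro h
      rw [star_sliceHom, sliceHom_apply, conj_re, conj_im] at h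
      have hre := congrArg QuaternionAlgebra.re h
      have him := congrArg (fun q : ℍ => ‖q.im‖) h
      simp only [re_slicePoint hI, re_slicePoint hJ, norm_im_slicePoint hI, norm_im_slicePoint hJ,
        abs_neg] at hre him
      rcases abs_eq_abs.1 him with h' | h'
      · exact hw (Complex.ext hre h')
      · exact hw' (Complex.ext (by simpa using hre) (by simp [h']))
    refine (if_neg hne).trans ?_
    rw [regularReciprocal_slicePoint hI hJ hw hw', zpow_negSucc, zpow_negSucc]

theorem starPow_sliceHom (hJ : J ∈ imaginaryUnits) {c w : ℂ} (hw : w ≠ c) (n : ℤ) :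
    starPow (sliceHom J hJ c) n (sliceHom J hJ w) = sliceHom J hJ ((w - c) ^ n) := by
  by_cases hw' : starRingEnd ℂ w = c
  · cases n with
    | ofNat n =>
      rw [sliceHom_apply hJ w]
      refine (starPow_ofNat_slicePoint hJ hJ c w n).trans ?_
      rw [represent_unit_self hJ]
      simp
    | negSucc m =>
      have h : sliceHom J hJ w = star (sliceHom J hJ c) := by
        rw [star_sliceHom, ← hw', conj_conj]
      refine (if_pos h).trans ?_
      rw [zpow_negSucc, map_inv₀, map_pow, map_sub]
  · rw [sliceHom_apply hJ w, starPow_slicePoint hJ hJ hw hw', represent_unit_self hJ]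

end SliceRegular

end StarPowers

/-! ### Geometry of the shells and the expansion -/

noncomputable section SigmaShells

open Metric Complex SliceRegular

namespace SliceRegular

variable {I J : ℍ}

theorem norm_sub_sq (q p : ℍ) : ‖q - p‖ ^ 2 = (q.re - p.re) ^ 2 + ‖q.im - p.im‖ ^ 2 := by
  rw [norm_sq_eq_re_im, Quaternion.re_sub, Quaternion.im_sub]

theorem sqrt_le_tauDist (q p : ℍ) :
    √((q.re - p.re) ^ 2 + (‖q.im‖ - ‖p.im‖) ^ 2) ≤ tauDist q p := by
  unfold tauDist
  split_ifs
  · rw [Real.sqrt_le_left (norm_nonneg _), norm_sub_sq]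
    refine add_le_add_right (sq_le_sq.2 ?_) _
    exact (abs_norm_sub_norm_le q.im p.im).trans (le_abs_self _)
  · exact le_rfl

theorem sigmaDist_le_omegaDist (q p : ℍ) : sigmaDist q p ≤ omegaDist q p := by
  unfold sigmaDist
  split_ifs
  · rw [omegaDist]
    refine Real.le_sqrt_of_sq_le ?_
    rw [norm_sub_sq]
    gcongr
    exact norm_sub_le q.im p.im
  · exact le_rfl

/-- The test depends only on `Re` and `|Im|`, so it admits the points `x + K y` for all units `K` at
once, whether or not they share a line with `p`. -/
theorem mem_sigmaShell_of_lt {q p : ℍ} {R₁ R₂ : ℝ≥0∞}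
    (h₁ : R₁ < ENNReal.ofReal √((q.re - p.re) ^ 2 + (‖q.im‖ - ‖p.im‖) ^ 2))
    (h₂ : ENNReal.ofReal (omegaDist q p) < R₂) : q ∈ sigmaShell p R₁ R₂ :=
  ⟨h₁.trans_le (ENNReal.ofReal_le_ofReal (sqrt_le_tauDist q p)),
    (ENNReal.ofReal_le_ofReal (sigmaDist_le_omegaDist q p)).trans_lt h₂⟩

theorem sliceHom_mem_sigmaShell_iff (hJ : J ∈ imaginaryUnits) {c w : ℂ} {R₁ R₂ : ℝ≥0∞} :
    sliceHom J hJ w ∈ sigmaShell (sliceHom J hJ c) R₁ R₂ ↔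
      R₁ < ENNReal.ofReal ‖w - c‖ ∧ ENNReal.ofReal ‖w - c‖ < R₂ := by
  have h : SameLine (sliceHom J hJ w) (sliceHom J hJ c) :=
    ⟨J, hJ, ⟨_, _, sliceHom_apply hJ w⟩, ⟨_, _, sliceHom_apply hJ c⟩⟩
  have h₁ : tauDist (sliceHom J hJ w) (sliceHom J hJ c) = ‖w - c‖ :=
    (if_pos h).trans (by rw [← map_sub, norm_sliceHom])
  have h₂ : sigmaDist (sliceHom J hJ w) (sliceHom J hJ c) = ‖w - c‖ :=
    (if_pos h).trans (by rw [← map_sub, norm_sliceHom])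
  unfold sigmaShell
  rw [Set.mem_ofPred_eq, h₁, h₂]

/-- A non-real `p` lies on only one complex line. -/
theorem im_eq_zero_of_sameLine (hJ : J ∈ imaginaryUnits) {p q : ℍ} (hp : p ∈ sliceLine J)
    (hq : q ∉ sliceLine J) (h : SameLine q p) : p.im = 0 := by
  obtain ⟨K, hK, ⟨a, b, rfl⟩, ⟨a', b', hp'⟩⟩ := h
  obtain ⟨x₀, y₀, rfl⟩ := hp
  have him := congrArg QuaternionAlgebra.im hp'
  by_contra hne
  apply hq
  rw [im_slicePoint hJ] at hne
  change (slicePoint J x₀ y₀).im = (slicePoint K a' b').im at him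
  rw [im_slicePoint hJ, im_slicePoint hK] at him
  have hb : b' ≠ 0 := by
    rintro rfl
    exact hne (by rw [him, zero_smul])
  refine ⟨a, b * b'⁻¹ * y₀, ?_⟩
  rw [slicePoint_eq, slicePoint_eq, mul_smul, him, smul_smul, inv_mul_cancel_right₀ hb]

theorem lt_of_mem_sigmaShell (hJ : J ∈ imaginaryUnits) {p q : ℍ} (hp : p ∈ sliceLine J)
    (hq : q ∉ sliceLine J) {R₁ R₂ : ℝ≥0∞} (h : q ∈ sigmaShell p R₁ R₂) :
    R₁ < ENNReal.ofReal √((q.re - p.re) ^ 2 + (‖q.im‖ - ‖p.im‖) ^ 2) ∧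
      ENNReal.ofReal (omegaDist q p) < R₂ := by
  unfold sigmaShell tauDist sigmaDist at h
  by_cases hs : SameLine q p
  · have h0 := im_eq_zero_of_sameLine hJ hp hq hs
    have h1 : ‖q - p‖ = √((q.re - p.re) ^ 2 + ‖q.im‖ ^ 2) := by
      rw [← Real.sqrt_sq (norm_nonneg (q - p)), norm_sub_sq, h0, sub_zero]
    simpa [hs, omegaDist, h0, h1] using h
  · simpa [hs] using h

/-- Follow the circle centred at the real point `x₀`: since `(γ t - x₀)² + (t y)²` is constant, only
the cross terms `∓2 t y y₀` vary, and both inequalities follow from `t ≤ 1`. -/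
theorem exists_continuous_arc (x x₀ y y₀ : ℝ) (hy : 0 ≤ y) (hy₀ : 0 ≤ y₀) :
    ∃ γ : ℝ → ℝ, Continuous γ ∧ γ 1 = x ∧ ∀ t ∈ Set.Icc (0 : ℝ) 1,
      (x - x₀) ^ 2 + (y - y₀) ^ 2 ≤ (γ t - x₀) ^ 2 + (t * y - y₀) ^ 2 ∧
      (γ t - x₀) ^ 2 + (t * y + y₀) ^ 2 ≤ (x - x₀) ^ 2 + (y + y₀) ^ 2 := by
  -- The sign `ε` selects the side of `x₀` on which `x` lies.
  obtain ⟨ε, hε, hεx⟩ : ∃ ε : ℝ, ε ^ 2 = 1 ∧ ε * |x - x₀| = x - x₀ := by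
    rcases abs_cases (x - x₀) with ⟨h, -⟩ | ⟨h, -⟩
    · exact ⟨1, by norm_num, by rw [h, one_mul]⟩
    · exact ⟨-1, by norm_num, by rw [h]; ring⟩
  refine ⟨fun t => x₀ + ε * √((x - x₀) ^ 2 + y ^ 2 - (t * y) ^ 2), by fun_prop, ?_, ?_⟩
  · beta_reduce
    rw [one_mul, add_sub_cancel_right, Real.sqrt_sq_eq_abs, hεx]
    ring
  · rintro t ⟨ht0, ht1⟩
    have hty : t * y ≤ y := mul_le_of_le_one_left hy ht1
    have hty0 : 0 ≤ t * y := mul_nonneg ht0 hy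
    have h1 : (x₀ + ε * √((x - x₀) ^ 2 + y ^ 2 - (t * y) ^ 2) - x₀) ^ 2 =
        (x - x₀) ^ 2 + y ^ 2 - (t * y) ^ 2 := by
      rw [add_sub_cancel_left, mul_pow, hε, one_mul, Real.sq_sqrt]
      nlinarith [sq_nonneg (x - x₀)]
    have h2 : t * y * y₀ ≤ y * y₀ := mul_le_mul_of_nonneg_right hty hy₀
    rw [h1]
    constructor <;> nlinarith

/-- The representation formula at the points of `Σ(p, R₁, R₂)` outside the complex line through
`p`. -/
theorem RegularOn.eq_represent_of_mem_sigmaShell {f : ℍ → ℍ} {Ω : Set ℍ} (hf : RegularOn f Ω)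
    (hΩ : IsOpen Ω) (hI : I ∈ imaginaryUnits) (hJ : J ∈ imaginaryUnits) {x₀ y₀ x y : ℝ}
    (hy₀ : 0 ≤ y₀) (hy : 0 ≤ y) {R₁ R₂ : ℝ≥0∞}
    (hsh : sigmaShell (slicePoint J x₀ y₀) R₁ R₂ ⊆ Ω)
    (h₁ : R₁ < ENNReal.ofReal √((x - x₀) ^ 2 + (y - y₀) ^ 2))
    (h₂ : ENNReal.ofReal √((x - x₀) ^ 2 + (y + y₀) ^ 2) < R₂) :
    f (slicePoint I x y) =
      represent J I (f (slicePoint J x y)) (f (slicePoint J x (-y))) := by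
  obtain ⟨γ, hγ, hγ1, hle⟩ := exists_continuous_arc x x₀ y y₀ hy hy₀
  have hmem : ∀ t ∈ Set.Icc (0 : ℝ) 1, ∀ K ∈ imaginaryUnits, ∀ s : ℝ, |s| = t * y →
      slicePoint K (γ t) s ∈ Ω := by
    intro t ht K hK s hs
    apply hsh
    apply mem_sigmaShell_of_lt
    · rw [re_slicePoint hK, re_slicePoint hJ, norm_im_slicePoint hK, norm_im_slicePoint hJ, hs,
        abs_of_nonneg hy₀]
      exact h₁.trans_le (ENNReal.ofReal_le_ofReal (Real.sqrt_le_sqrt (hle t ht).1))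
    · rw [omegaDist, re_slicePoint hK, re_slicePoint hJ, norm_im_slicePoint hK,
        norm_im_slicePoint hJ, hs, abs_of_nonneg hy₀]
      exact (ENNReal.ofReal_le_ofReal (Real.sqrt_le_sqrt (hle t ht).2)).trans_lt h₂
  have := hf.eq_represent hΩ hI hJ hγ y fun t ht =>
    ⟨hmem t ht I hI _ (abs_of_nonneg (mul_nonneg ht.1 hy)),
      hmem t ht J hJ _ (abs_of_nonneg (mul_nonneg ht.1 hy)),
      hmem t ht J hJ _ (by rw [abs_neg, abs_of_nonneg (mul_nonneg ht.1 hy)])⟩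
  rwa [hγ1] at this

/-- The Laurent coefficients at `c` of the restriction of `f` to `ℝ + J ℝ`, computed on the circle
of radius `r`. -/
def sliceLaurentCoeff (f : ℍ → ℍ) (J : ℍ) (hJ : J ∈ imaginaryUnits) (c : ℂ) (r : ℝ) (n : ℤ) : ℍ :=
  letI := sliceNormedSpace J hJ
  laurentCoeff (fun w : ℂ => f (slicePoint J w.re w.im)) c r n

theorem closedBall_diff_ball_subset (hJ : J ∈ imaginaryUnits) {Ω : Set ℍ} {c : ℂ} {R₁ R₂ : ℝ≥0∞}
    (hsh : sigmaShell (sliceHom J hJ c) R₁ R₂ ⊆ Ω) {r R : ℝ} (hr : R₁ < ENNReal.ofReal r)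
    (hR : ENNReal.ofReal R < R₂) :
    closedBall c R \ ball c r ⊆ {w : ℂ | slicePoint J w.re w.im ∈ Ω} := by
  rintro w ⟨hw1, hw2⟩
  change slicePoint J w.re w.im ∈ Ω
  rw [← sliceHom_apply hJ]
  refine hsh ((sliceHom_mem_sigmaShell_iff hJ).2 ⟨?_, ?_⟩)
  · exact hr.trans_le (ENNReal.ofReal_le_ofReal (not_lt.1 fun h => hw2 (mem_ball_iff_norm.2 h)))
  · exact (ENNReal.ofReal_le_ofReal (mem_closedBall_iff_norm.1 hw1)).trans_lt hR

theorem isOpen_setOf_slicePoint_mem {Ω : Set ℍ} (hΩ : IsOpen Ω) (J : ℍ) :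
    IsOpen {w : ℂ | slicePoint J w.re w.im ∈ Ω} :=
  (isOpen_sliceSet hΩ J).preimage Complex.equivRealProdCLM.continuous

theorem RegularOn.sliceLaurentCoeff_eq {f : ℍ → ℍ} {Ω : Set ℍ} (hf : RegularOn f Ω)
    (hΩ : IsOpen Ω) (hJ : J ∈ imaginaryUnits) {c : ℂ} {R₁ R₂ : ℝ≥0∞}
    (hsh : sigmaShell (sliceHom J hJ c) R₁ R₂ ⊆ Ω) {s t : ℝ≥0∞} (hs : s ∈ Set.Ioo R₁ R₂)
    (ht : t ∈ Set.Ioo R₁ R₂) (n : ℤ) :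
    sliceLaurentCoeff f J hJ c s.toReal n = sliceLaurentCoeff f J hJ c t.toReal n := by
  wlog hst : s ≤ t generalizing s t
  · exact (this ht hs (le_of_not_ge hst)).symm
  have hs' : s ≠ ∞ := hs.2.ne_top
  have ht' : t ≠ ∞ := ht.2.ne_top
  have hsub := closedBall_diff_ball_subset hJ hsh (r := s.toReal) (R := t.toReal)
    (by rw [ENNReal.ofReal_toReal hs']; exact hs.1) (by rw [ENNReal.ofReal_toReal ht']; exact ht.2)
  have hd := (hf J hJ).differentiableOn hΩ hJ
  let _ := sliceNormedSpace J hJ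
  exact (laurentCoeff_eq_of_differentiableOn (isOpen_setOf_slicePoint_mem hΩ J) hd
    (ENNReal.toReal_pos (pos_of_gt hs.1).ne' hs') (ENNReal.toReal_mono ht' hst) hsub n).symm

theorem RegularOn.hasSum_sliceLaurentCoeff {f : ℍ → ℍ} {Ω : Set ℍ} (hf : RegularOn f Ω)
    (hΩ : IsOpen Ω) (hJ : J ∈ imaginaryUnits) {c : ℂ} {R₁ R₂ : ℝ≥0∞}
    (hsh : sigmaShell (sliceHom J hJ c) R₁ R₂ ⊆ Ω) {w : ℂ}
    (h₁ : R₁ < ENNReal.ofReal ‖w - c‖) (h₂ : ENNReal.ofReal ‖w - c‖ < R₂) :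
    HasSum (fun n : ℤ => sliceHom J hJ ((w - c) ^ n) * sliceLaurentCoeff f J hJ c ‖w - c‖ n)
      (f (slicePoint J w.re w.im)) := by
  obtain ⟨r, hr1, hr2⟩ := exists_between h₁
  obtain ⟨R, hR1, hR2⟩ := exists_between h₂
  have hr' : r ≠ ∞ := hr2.ne_top
  have hR' : R ≠ ∞ := hR2.ne_top
  have hsub := closedBall_diff_ball_subset hJ hsh (r := r.toReal) (R := R.toReal)
    (by rwa [ENNReal.ofReal_toReal hr']) (by rwa [ENNReal.ofReal_toReal hR'])
  have hd := (hf J hJ).differentiableOn hΩ hJ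
  let _ := sliceNormedSpace J hJ
  exact hasSum_laurentCoeff (isOpen_setOf_slicePoint_mem hΩ J) hd
    (ENNReal.toReal_pos (pos_of_gt hr1).ne' hr') hsub
    ((ENNReal.lt_ofReal_iff_toReal_lt hr').1 hr2)
    ((ENNReal.ofReal_lt_iff_lt_toReal (norm_nonneg _) hR').1 hR1)

/-- Around each admissible radius there is an open interval on which the coefficient is constant; a
locally constant function is constant on a connected set. -/
theorem RegularOn.sliceLaurentCoeff_eq_of_mem_connectedComponentIn {f : ℍ → ℍ} {Ω : Set ℍ}
    (hf : RegularOn f Ω) (hΩ : IsOpen Ω) (hJ : J ∈ imaginaryUnits) {c : ℂ} {r s : ℝ≥0∞}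
    (hr : r ∈ admissibleRadii Ω (sliceHom J hJ c))
    (hs : s ∈ connectedComponentIn (admissibleRadii Ω (sliceHom J hJ c)) r) (n : ℤ) :
    sliceLaurentCoeff f J hJ c s.toReal n = sliceLaurentCoeff f J hJ c r.toReal n := by
  refine isPreconnected_connectedComponentIn.induction₂
    (fun s t : ℝ≥0∞ =>
      sliceLaurentCoeff f J hJ c s.toReal n = sliceLaurentCoeff f J hJ c t.toReal n)
    (fun x hx => ?_) (fun _ _ _ _ _ _ => Eq.trans) (fun _ _ _ _ => Eq.symm) hs
    (mem_connectedComponentIn hr)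
  obtain ⟨R₁, R₂, hadm, hxR⟩ := connectedComponentIn_subset _ _ hx
  filter_upwards [mem_nhdsWithin_of_mem_nhds (Ioo_mem_nhds hxR.1 hxR.2)] with t ht
  exact hf.sliceLaurentCoeff_eq hΩ hJ hadm.2 hxR ht n

theorem _root_.HasSum.represent {ι : Type*} (J I : ℍ) {u v : ι → ℍ} {a b : ℍ} (hu : HasSum u a)
    (hv : HasSum v b) :
    HasSum (fun i => SliceRegular.represent J I (u i) (v i)) (SliceRegular.represent J I a b) :=
  ((hu.mul_left _).add (hv.mul_left _)).const_smul _

theorem norm_sub_eq_sqrt (w c : ℂ) : ‖w - c‖ = √((w.re - c.re) ^ 2 + (w.im - c.im) ^ 2) := by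
  rw [norm_eq_sqrt_sq_add_sq, sub_re, sub_im]

/-- The **Laurent expansion** of a slice regular function around `p`. -/
theorem RegularOn.exists_laurent_expansion {f : ℍ → ℍ} {Ω : Set ℍ} (hf : RegularOn f Ω)
    (hΩ_open : IsOpen Ω) {p : ℍ} {r : ℝ≥0∞} (hr : r ∈ admissibleRadii Ω p) :
    ∃ a : ℤ → ℍ, ∀ R₁ R₂ : ℝ≥0∞, Admissible Ω p R₁ R₂ →
      Set.Ioo R₁ R₂ ⊆ connectedComponentIn (admissibleRadii Ω p) r →
      ∀ q ∈ sigmaShell p R₁ R₂, HasSum (fun n : ℤ => starPow p n q * a n) (f q) := by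
  obtain ⟨J, hJ, hpJ⟩ := exists_eq_slicePoint p
  obtain ⟨c, hc⟩ : ∃ c : ℂ, c = ⟨p.re, ‖p.im‖⟩ := ⟨_, rfl⟩
  have hpc : p = sliceHom J hJ c := by
    rw [sliceHom_apply, hc]
    exact hpJ
  refine ⟨sliceLaurentCoeff f J hJ c r.toReal, fun R₁ R₂ hadm hsub q hq => ?_⟩
  have hsh : sigmaShell (sliceHom J hJ c) R₁ R₂ ⊆ Ω := hpc ▸ hadm.2
  have hexp : ∀ w : ℂ, R₁ < ENNReal.ofReal ‖w - c‖ → ENNReal.ofReal ‖w - c‖ < R₂ →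
      HasSum (fun n : ℤ => sliceHom J hJ ((w - c) ^ n) * sliceLaurentCoeff f J hJ c r.toReal n)
        (f (slicePoint J w.re w.im)) := by
    intro w h₁ h₂
    have hmem := hsub ⟨h₁, h₂⟩
    rw [hpc] at hmem hr
    have hcoeff := hf.sliceLaurentCoeff_eq_of_mem_connectedComponentIn hΩ_open hJ hr hmem
    rw [ENNReal.toReal_ofReal (norm_nonneg _)] at hcoeff
    simpa only [hcoeff] using hf.hasSum_sliceLaurentCoeff hΩ_open hJ hsh h₁ h₂
  have hne : ∀ w : ℂ, R₁ < ENNReal.ofReal ‖w - c‖ → w ≠ c := by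
    rintro w h rfl
    simp at h
  by_cases hqJ : q ∈ sliceLine J
  · obtain ⟨x, y, hxy⟩ := hqJ
    have hqw : q = sliceHom J hJ ⟨x, y⟩ := by rw [sliceHom_apply]; exact hxy
    rw [hqw, hpc, sliceHom_mem_sigmaShell_iff] at hq
    have h := hexp ⟨x, y⟩ hq.1 hq.2
    rw [← sliceHom_apply hJ, ← hqw] at h
    convert h using 3 with n
    rw [hpc, hqw, starPow_sliceHom hJ (hne _ hq.1)]
  · obtain ⟨I, hI, hqI⟩ := exists_eq_slicePoint q
    obtain ⟨h₁, h₂⟩ := lt_of_mem_sigmaShell hJ ⟨_, _, hpJ⟩ hqJ hq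
    rw [omegaDist] at h₂
    have hle : √((q.re - p.re) ^ 2 + (‖q.im‖ - ‖p.im‖) ^ 2) ≤
        √((q.re - p.re) ^ 2 + (‖q.im‖ + ‖p.im‖) ^ 2) := by
      apply Real.sqrt_le_sqrt
      nlinarith [norm_nonneg q.im, norm_nonneg p.im,
        mul_nonneg (norm_nonneg q.im) (norm_nonneg p.im)]
    -- `w` and `w̄` represent the points of `ℝ + J ℝ` with the real part and `|Im|` of `q`. As `c.im
    -- = ‖p.im‖`, their distances to `c` are the two square roots in `hle`, both strictly between
    -- `R₁` and `R₂`.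
    obtain ⟨w, hw⟩ : ∃ w : ℂ, w = ⟨q.re, ‖q.im‖⟩ := ⟨_, rfl⟩
    have hn1 : ‖w - c‖ = √((q.re - p.re) ^ 2 + (‖q.im‖ - ‖p.im‖) ^ 2) := by
      rw [norm_sub_eq_sqrt, hw, hc]
    have hn2 : ‖starRingEnd ℂ w - c‖ = √((q.re - p.re) ^ 2 + (‖q.im‖ + ‖p.im‖) ^ 2) := by
      rw [norm_sub_eq_sqrt, Complex.conj_re, Complex.conj_im, hw, hc]
      congr 2
      ring
    have hle' := ENNReal.ofReal_le_ofReal hle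
    have hw1 : R₁ < ENNReal.ofReal ‖w - c‖ := by rwa [hn1]
    have hw2 : ENNReal.ofReal ‖w - c‖ < R₂ := by rw [hn1]; exact hle'.trans_lt h₂
    have hw3 : R₁ < ENNReal.ofReal ‖starRingEnd ℂ w - c‖ := by rw [hn2]; exact h₁.trans_le hle'
    have hw4 : ENNReal.ofReal ‖starRingEnd ℂ w - c‖ < R₂ := by rwa [hn2]
    have hfq : f q = represent J I (f (slicePoint J w.re w.im))
        (f (slicePoint J (starRingEnd ℂ w).re (starRingEnd ℂ w).im)) := by
      rw [Complex.conj_re, Complex.conj_im, hw]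
      conv_lhs => rw [hqI]
      exact hf.eq_represent_of_mem_sigmaShell hΩ_open hI hJ (norm_nonneg p.im) (norm_nonneg q.im)
        (hpJ ▸ hadm.2) h₁ h₂
    rw [hfq]
    convert (hexp w hw1 hw2).represent J I (hexp _ hw3 hw4) using 2 with n
    rw [← represent_mul_right, ← starPow_slicePoint hI hJ (hne _ hw1) (hne _ hw3), ← hpc, hw,
      ← hqI]

end SliceRegular

end SigmaShells

/-- The point `r` names its component of the admissible radii. `HasSum` over `ℤ` is unconditional,
which in the finite-dimensional space `ℍ` amounts to absolute convergence. -/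
theorem mainTheorem4 (Ω : Set (Quaternion ℝ)) (hΩ_open : IsOpen Ω) (hΩ_conn : IsConnected Ω)
    (f : Quaternion ℝ → Quaternion ℝ) (hf : SliceRegular.RegularOn f Ω) (p : Quaternion ℝ) :
    ∀ r ∈ SliceRegular.admissibleRadii Ω p,
      ∃ a : ℤ → Quaternion ℝ, ∀ R₁ R₂ : ENNReal, SliceRegular.Admissible Ω p R₁ R₂ →
        Set.Ioo R₁ R₂ ⊆ connectedComponentIn (SliceRegular.admissibleRadii Ω p) r →
        ∀ q ∈ SliceRegular.sigmaShell p R₁ R₂,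
          HasSum (fun n : ℤ => SliceRegular.starPow p n q * a n) (f q) := by
  exact fun r hr => hf.exists_laurent_expansion hΩ_open hr
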